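/- Let $\mathscr A$ be a finite alphabet with the discrete topology (for example $\mathscr A=\{0,1\}$), let $\mathscr A^\infty=\mathscr A^{\mathbb N_0}$ carry the product topology and the metric $\rho(x,y)=2^{-\min\{n\,:\,x_n\ne y_n\}}$ ($\rho(x,x)=0$), and let $\sigma(x)_n=x_{n+1}$. A shift space is a nonempty closed set $X\subseteq\mathscr A^\infty$ with $\sigma(X)\subseteq X$; it is surjective if $\sigma(X)=X$. Its language $\mathcal L(X)$ is the set of all finite words that are prefixes of points of $X$. For $E\subseteq\mathbb N_0$ let $\bar d(E)=\limsup_{n\to\infty}\frac1n|E\cap[0,n)|$ and $\underline d(E)=\liminf_{n\to\infty}\frac1n|E\cap[0,n)|$, and write $d(E)=c$ if $\bar d(E)=\underline d(E)=c$. For $x,y\in\mathscr A^\infty$ let $\bar d(x,y)=\bar d(\{n: x_n\neq y_n\})$. Definitions, for a shift space $X$ and points $x^{(n)},z\in X$: - $X$ has the asymptotic average shadowing property if for every sequence $(x^{(n)})_{n\ge0}$ in $X$ with $\limsup_{n}\frac1n\sum_{i<n}\rho(\sigma(x^{(i)}),x^{(i+1)})=0$ there is $z\in X$ with $\limsup_{n}\frac1n\sum_{i<n}\rho(\sigma^i(z),x^{(i)})=0$.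 - A sequence $(x^{(n)})_{n\ge0}$ in $X$ is a vague pseudo-orbit if for every open set $U\subseteq X^{\mathbb N_0}$ (product topology) containing all orbits $(\sigma^k(y))_{k\ge0}$, $y\in X$, one has $d(\{n: (x^{(n+k)})_{k\ge0}\in U\})=1$. $X$ has the vague specification property if for every vague pseudo-orbit there is $z\in X$ such that $d(\{n:\rho(\sigma^n(z),x^{(n)})<\varepsilon\})=1$ for every $\varepsilon>0$. - $X$ is $\bar d$-complete if every sequence in $X$ that is Cauchy for $\bar d$ converges with respect to $\bar d$ to some point of $X$. - $X$ has the $\bar d$-shadowing property if for every $\varepsilon>0$ there is $N\ge1$ such that for every sequence of words $w^{(1)},w^{(2)},\ldots\in\mathcal L(X)$ of lengths at least $N$ there is $x\in X$ with $\bar d(x,w^{(1)}w^{(2)}\cdots)<\varepsilon$. Theorem. Let $X$ be a surjective shift space. Then $X$ has the asymptotic average shadowing property if and only if $X$ is $\bar d$-complete and has the $\bar d$-shadowing property. Likewise, $X$ has the vague specification property if and only if $X$ is $\bar d$-complete and has the $\bar d$-shadowing property. -/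

import Mathlib

open Filter Topology
open SymbolicDynamics.FullShift (Subshift shift)

/- The metric `dist x y = (1/2) ^ (min {n | x n ≠ y n})` (and `0` if `x = y`) on sequences of letters;
its topology is the product of the discrete topologies. -/
attribute [local instance] PiNat.metricSpace

namespace ShiftSpace

noncomputable section

/-! ### Densities of sets of natural numbers -/

/-- Upper asymptotic density `limsup |E ∩ [0, n)| / n`. -/
def upperDensity (E : Set ℕ) : ℝ :=
  limsup (fun n : ℕ => ((E ∩ Set.Ico 0 n).ncard : ℝ) / n) atTop

/-- Lower asymptotic density `liminf |E ∩ [0, n)| / n`. -/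
def lowerDensity (E : Set ℕ) : ℝ :=
  liminf (fun n : ℕ => ((E ∩ Set.Ico 0 n).ncard : ℝ) / n) atTop

/-- The asymptotic density of `E` exists and equals `c`. -/
def HasDensity (E : Set ℕ) (c : ℝ) : Prop :=
  upperDensity E = c ∧ lowerDensity E = c

/-! ### Pseudo-orbits and tracing in a dynamical system

These notions are used for a continuous self-map `T` of a compact metric space, so that all the
real sequences whose upper limits are taken below are bounded. -/

section Dynamics

variable {X : Type*} [MetricSpace X]

/-- The orbit of `z` as a sequence `z, T z, T (T z), …`. -/
def orbitSeq (T : X → X) (z : X) : ℕ → X := fun n => T^[n] z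

/-- The Besicovitch pseudometric on sequences of points. -/
def besicovitch (x z : ℕ → X) : ℝ :=
  limsup (fun n : ℕ => (1 / (n : ℝ)) * ∑ i ∈ Finset.range n, dist (x i) (z i)) atTop

/-- Asymptotic average pseudo-orbits. -/
def IsAsymptoticAveragePseudoOrbit (T : X → X) (x : ℕ → X) : Prop :=
  limsup (fun n : ℕ => (1 / (n : ℝ)) * ∑ i ∈ Finset.range n, dist (T (x i)) (x (i + 1))) atTop = 0

/-- The asymptotic average shadowing property of `(X, T)`. -/
def AsymptoticAverageShadowing (T : X → X) : Prop :=
  ∀ x : ℕ → X, IsAsymptoticAveragePseudoOrbit T x → ∃ z : X, besicovitch (orbitSeq T z) x = 0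

/-- Vague pseudo-orbits: for every open neighbourhood `U` of the set of all orbits in the product
space of sequences of points, the tails `(x n, x (n+1), …)` lie in `U` for a set of `n` of
density `1`. -/
def IsVaguePseudoOrbit (T : X → X) (x : ℕ → X) : Prop :=
  ∀ U : Set (ℕ → X), @IsOpen _ Pi.topologicalSpace U → Set.range (orbitSeq T) ⊆ U →
    HasDensity {n : ℕ | (fun k => x (n + k)) ∈ U} 1

/-- The vague specification property of `(X, T)`. -/
def VagueSpecification (T : X → X) : Prop :=
  ∀ x : ℕ → X, IsVaguePseudoOrbit T x →
    ∃ z : X, ∀ ε : ℝ, 0 < ε → HasDensity {n : ℕ | dist (T^[n] z) (x n) < ε} 1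

end Dynamics

/-! ### Shift spaces -/

section Symbolic

variable {A : Type*}

/-- The pseudometric `d̄` on sequences of letters. -/
def dbar (x y : ℕ → A) : ℝ := upperDensity {n : ℕ | x n ≠ y n}

lemma le_length_flatMap_range (w : ℕ → List A) (hw : ∀ i, w i ≠ []) (n : ℕ) :
    n ≤ ((List.range n).flatMap w).length := by
  induction n with
  | zero => simp
  | succ n ih =>
    have h := List.length_pos_iff.mpr (hw n)
    simp only [List.range_succ, List.flatMap_append, List.length_append, List.flatMap_singleton]
    omega

/-- The infinite concatenation `w 0 w 1 w 2 …` of nonempty words: its `n`-th letter is the `n`-th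
letter of the finite word `w 0 w 1 … w n`. -/
def concat (w : ℕ → List A) (hw : ∀ i, w i ≠ []) : ℕ → A := fun n =>
  ((List.range (n + 1)).flatMap w)[n]'(le_length_flatMap_range w hw (n + 1))

variable [TopologicalSpace A]

/-- The shift map as a self-map of the shift space `X`. -/
def shiftMap (X : Subshift A ℕ) : X.carrier → X.carrier :=
  (X.mapsTo 1).restrict

/-- The language of `X`: the words that are prefixes of points of `X`. -/
def language (X : Subshift A ℕ) : Set (List A) :=
  {w | ∃ x ∈ X.carrier, ∀ (i : ℕ) (hi : i < w.length), x i = w[i]}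

/-- `X` is complete for the pseudometric `d̄`. -/
def DbarComplete (X : Subshift A ℕ) : Prop :=
  ∀ z : ℕ → (ℕ → A), (∀ n, z n ∈ X.carrier) →
    (∀ ε : ℝ, 0 < ε → ∃ N : ℕ, ∀ n ≥ N, ∀ m ≥ N, dbar (z n) (z m) < ε) →
    ∃ y ∈ X.carrier, Tendsto (fun n => dbar (z n) y) atTop (𝓝 0)

/-- The `d̄`-shadowing property. (The hypothesis `hw` follows from the bound on the lengths, and
is there for the concatenation to be defined.) -/
def DbarShadowing (X : Subshift A ℕ) : Prop :=
  ∀ ε : ℝ, 0 < ε → ∃ N : ℕ, 1 ≤ N ∧ ∀ (w : ℕ → List A) (hw : ∀ i, w i ≠ []),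
    (∀ i, w i ∈ language X) → (∀ i, N ≤ (w i).length) →
      ∃ x ∈ X.carrier, dbar x (concat w hw) < ε

end Symbolic

end

end ShiftSpace

/-! Both tracing properties depend only on which letters are seen in finite windows, and both amount
to `TracesAlmostInLanguage`: a sequence `y` of letters for which, for each `k`, the windows of
length `k` outside the language start at a set of density zero is at `d̄`-distance zero from a point
of `X`. For vague pseudo-orbits this reduction needs compactness (`exists_forall_mem_of_isOpen`);
otherwise it replaces a pseudo-orbit by the sequence of its zeroth letters, and back
(`tracesWindows_iff`).

This property gives `d̄`-completeness because the full shift is `d̄`-complete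
(`exists_tendsto_dbar`) and a `d̄`-limit of points of `X` has almost all its windows in the
language. It gives `d̄`-shadowing in two steps. Finite words with sparse cuts are uniformly
approximable (`exists_countBelow_le`): otherwise, bad words repeated over rapidly growing stages
form a sequence to be traced, and no point of `X` can trace it. An infinite concatenation is then
approximated on the blocks between consecutive squares, whose ends have density zero, and the
resulting sequence is traced (`exists_dbar_lt`).

Conversely, `d̄`-shadowing approximates `y` by points of `X` within every `ε`, and `d̄`-completeness
supplies their limit. -/

namespace ShiftSpace
noncomputable section

/-! ### Counting functions and upper densities -/

/-- The number of elements of `E` below `n`. -/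
def countBelow (E : Set ℕ) (n : ℕ) : ℕ := (E ∩ Set.Ico 0 n).ncard

lemma finite_inter_Ico (E : Set ℕ) (n : ℕ) : (E ∩ Set.Ico 0 n).Finite :=
  (Set.finite_Ico 0 n).subset Set.inter_subset_right

lemma countBelow_le_of_forall {E F : Set ℕ} {n : ℕ} (h : ∀ i < n, i ∈ E → i ∈ F) :
    countBelow E n ≤ countBelow F n :=
  Set.ncard_le_ncard (fun i hi => ⟨h i hi.2.2 hi.1, hi.2⟩) (finite_inter_Ico F n)

lemma countBelow_le (E : Set ℕ) (n : ℕ) : countBelow E n ≤ n := by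
  have h := Set.ncard_le_ncard (s := E ∩ Set.Ico 0 n) Set.inter_subset_right (Set.finite_Ico 0 n)
  have h2 : (Set.Ico 0 n).ncard = n := by
    rw [← Finset.coe_Ico, Set.ncard_coe_finset]; simp
  exact h.trans h2.le

lemma countBelow_union_le (E F : Set ℕ) (n : ℕ) :
    countBelow (E ∪ F) n ≤ countBelow E n + countBelow F n := by
  unfold countBelow
  rw [Set.union_inter_distrib_right]
  exact Set.ncard_union_le _ _

lemma countBelow_add_compl (E : Set ℕ) (n : ℕ) : countBelow E n + countBelow Eᶜ n = n := by
  unfold countBelow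
  rw [← Set.ncard_union_eq _ (finite_inter_Ico E n) (finite_inter_Ico Eᶜ n),
    ← Set.union_inter_distrib_right, Set.union_compl_self, Set.univ_inter, ← Finset.coe_Ico,
    Set.ncard_coe_finset]
  · simp
  · exact (disjoint_compl_right).mono Set.inter_subset_left Set.inter_subset_left

lemma countBelow_add (E : Set ℕ) (a b : ℕ) :
    countBelow E (a + b) = countBelow E a + countBelow {i | a + i ∈ E} b := by
  have h : (fun i => a + i) '' ({i | a + i ∈ E} ∩ Set.Ico 0 b) = E ∩ Set.Ico a (a + b) := by
    ext i
    constructor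
    · rintro ⟨j, ⟨hj, hj'⟩, rfl⟩
      exact ⟨hj, by simp at hj' ⊢; omega⟩
    · rintro ⟨hi, hi'⟩
      simp only [Set.mem_Ico] at hi'
      have : a + (i - a) = i := by omega
      exact ⟨i - a, ⟨by simpa [this] using hi, by simp; omega⟩, this⟩
  unfold countBelow
  rw [← Set.ncard_image_of_injective ({i | a + i ∈ E} ∩ Set.Ico 0 b) (add_right_injective a), h,
    ← Set.ncard_union_eq]
  · congr 1
    ext i
    simp only [Set.mem_inter_iff, Set.mem_union, Set.mem_Ico]
    constructor
    · rintro ⟨h1, h2⟩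
      rcases lt_or_ge i a with h3 | h3
      · exact Or.inl ⟨h1, by omega⟩
      · exact Or.inr ⟨h1, by omega⟩
    · rintro (⟨h1, h2⟩ | ⟨h1, h2⟩)
      · exact ⟨h1, by omega⟩
      · exact ⟨h1, by omega⟩
  · rw [Set.disjoint_left]
    rintro i ⟨_, h1⟩ ⟨_, h2⟩
    simp at h1 h2
    omega

lemma countBelow_mono (E : Set ℕ) {m n : ℕ} (h : m ≤ n) : countBelow E m ≤ countBelow E n := by
  obtain ⟨b, rfl⟩ := Nat.exists_eq_add_of_le h
  rw [countBelow_add]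
  omega

lemma countBelow_add_le (E : Set ℕ) (a b : ℕ) : countBelow E (a + b) ≤ countBelow E a + b := by
  rw [countBelow_add]
  have := countBelow_le {i | a + i ∈ E} b
  omega

lemma limsup_le_iff_forall_eventually {u : ℕ → ℝ} (h0 : ∀ n, 0 ≤ u n) (h1 : ∀ n, u n ≤ 1)
    {c : ℝ} : limsup u atTop ≤ c ↔ ∀ ε > 0, ∀ᶠ n in atTop, u n ≤ c + ε := by
  have hb : IsBoundedUnder (· ≤ ·) atTop u := isBoundedUnder_of ⟨1, h1⟩
  have hc : IsCoboundedUnder (· ≤ ·) atTop u :=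
    (isBoundedUnder_of ⟨0, h0⟩ : IsBoundedUnder (· ≥ ·) atTop u).isCoboundedUnder_le
  constructor
  · intro h ε hε
    exact (eventually_lt_of_limsup_lt (lt_of_le_of_lt h (by linarith : c < c + ε)) hb).mono
      fun n hn => hn.le
  · intro h
    refine le_of_forall_pos_le_add fun ε hε => ?_
    exact limsup_le_of_le hc (h ε hε)

lemma limsup_nonneg {u : ℕ → ℝ} (h0 : ∀ n, 0 ≤ u n) (h1 : ∀ n, u n ≤ 1) :
    0 ≤ limsup u atTop :=
  le_limsup_of_frequently_le (Frequently.of_forall h0) (isBoundedUnder_of ⟨1, h1⟩)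

lemma limsup_average_le_iff {S : ℕ → ℝ} (h0 : ∀ n, 0 ≤ S n) (h1 : ∀ n, S n ≤ n) {c : ℝ} :
    limsup (fun n : ℕ => S n / n) atTop ≤ c ↔ ∀ ε > 0, ∀ᶠ n : ℕ in atTop, S n ≤ (c + ε) * n := by
  rw [limsup_le_iff_forall_eventually (fun n => div_nonneg (h0 n) n.cast_nonneg)
    (fun n => div_le_one_of_le₀ (h1 n) n.cast_nonneg)]
  refine forall₂_congr fun ε _ => eventually_congr ?_
  filter_upwards [eventually_gt_atTop 0] with n hn
  rw [div_le_iff₀ (by exact_mod_cast hn)]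

lemma upperDensity_le_iff {E : Set ℕ} {c : ℝ} :
    upperDensity E ≤ c ↔ ∀ ε > 0, ∀ᶠ n : ℕ in atTop, (countBelow E n : ℝ) ≤ (c + ε) * n :=
  limsup_average_le_iff (S := fun n => (countBelow E n : ℝ)) (fun _ => Nat.cast_nonneg _)
    (fun n => by exact_mod_cast countBelow_le E n)

lemma countBelow_div_le_one (E : Set ℕ) (n : ℕ) : (countBelow E n : ℝ) / n ≤ 1 :=
  div_le_one_of_le₀ (by exact_mod_cast countBelow_le E n) n.cast_nonneg

lemma upperDensity_nonneg (E : Set ℕ) : 0 ≤ upperDensity E :=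
  limsup_nonneg (u := fun n : ℕ => (countBelow E n : ℝ) / n) (fun n => by positivity)
    (countBelow_div_le_one E)

lemma upperDensity_eq_zero_iff_le {E : Set ℕ} : upperDensity E = 0 ↔ upperDensity E ≤ 0 :=
  ⟨fun h => h.le, fun h => h.antisymm (upperDensity_nonneg E)⟩

lemma eventually_countBelow_le {E : Set ℕ} {c : ℝ} (h : upperDensity E < c) :
    ∀ᶠ n : ℕ in atTop, (countBelow E n : ℝ) ≤ c * n := by
  have := upperDensity_le_iff.1 (le_refl (upperDensity E)) (c - upperDensity E) (sub_pos.2 h)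
  simpa using this

lemma upperDensity_le_of_forall {E : Set ℕ} {c C : ℝ}
    (h : ∀ n : ℕ, (countBelow E n : ℝ) ≤ C + c * n) : upperDensity E ≤ c := by
  rw [upperDensity_le_iff]
  intro ε hε
  have : ∀ᶠ n : ℕ in atTop, C / ε ≤ n := tendsto_natCast_atTop_atTop.eventually_ge_atTop _
  filter_upwards [this] with n hn
  rw [div_le_iff₀ hε] at hn
  linarith [h n]

lemma upperDensity_mono {E F : Set ℕ} (h : E ⊆ F) : upperDensity E ≤ upperDensity F := by
  rw [upperDensity_le_iff]
  intro ε hε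
  filter_upwards [upperDensity_le_iff.1 (le_refl (upperDensity F)) ε hε] with n hn
  exact le_trans (by exact_mod_cast countBelow_le_of_forall fun i _ hi => h hi) hn

lemma upperDensity_eq_zero_of_subset {E F : Set ℕ} (h : E ⊆ F) (hF : upperDensity F = 0) :
    upperDensity E = 0 :=
  upperDensity_eq_zero_iff_le.2 ((upperDensity_mono h).trans hF.le)

lemma upperDensity_union_le (E F : Set ℕ) :
    upperDensity (E ∪ F) ≤ upperDensity E + upperDensity F := by
  rw [upperDensity_le_iff]
  intro ε hε
  filter_upwards [upperDensity_le_iff.1 (le_refl (upperDensity E)) (ε / 2) (by positivity),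
    upperDensity_le_iff.1 (le_refl (upperDensity F)) (ε / 2) (by positivity)] with n h1 h2
  have h3 : (countBelow (E ∪ F) n : ℝ) ≤ countBelow E n + countBelow F n := by
    exact_mod_cast countBelow_union_le E F n
  linarith

lemma upperDensity_union_eq_zero {E F : Set ℕ} (hE : upperDensity E = 0)
    (hF : upperDensity F = 0) : upperDensity (E ∪ F) = 0 :=
  upperDensity_eq_zero_iff_le.2 ((upperDensity_union_le E F).trans (by rw [hE, hF, add_zero]))

lemma upperDensity_setOf_lt (k : ℕ) : upperDensity {n | n < k} = 0 := by
  refine upperDensity_eq_zero_iff_le.2 (upperDensity_le_of_forall (C := k) fun n => ?_)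
  have : countBelow {n | n < k} n ≤ k := by
    rcases le_total n k with h | h
    · exact (countBelow_le _ n).trans h
    · obtain ⟨b, rfl⟩ := Nat.exists_eq_add_of_le h
      rw [countBelow_add]
      have h1 := countBelow_le {n | n < k} k
      have h2 : countBelow {i | k + i ∈ {n | n < k}} b = 0 := by simp [countBelow]
      omega
  simpa using this

lemma upperDensity_empty : upperDensity ∅ = 0 :=
  upperDensity_eq_zero_of_subset (Set.empty_subset _) (upperDensity_setOf_lt 0)

lemma upperDensity_exists_lt_le {E : ℕ → Set ℕ} {c : ℝ} {k : ℕ}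
    (h : ∀ i < k, upperDensity (E i) ≤ c) : upperDensity {n | ∃ i < k, n ∈ E i} ≤ k * c := by
  induction k with
  | zero => simp [upperDensity_empty]
  | succ k ih =>
    have h1 : {n | ∃ i < k + 1, n ∈ E i} ⊆ {n | ∃ i < k, n ∈ E i} ∪ E k := by
      rintro n ⟨i, hi, hn⟩
      rcases Nat.lt_succ_iff_lt_or_eq.1 hi with h | rfl
      · exact Or.inl ⟨i, h, hn⟩
      · exact Or.inr hn
    have := (upperDensity_mono h1).trans (upperDensity_union_le _ _)
    push_cast
    linarith [ih fun i hi => h i (by omega), h k (by omega)]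

lemma upperDensity_exists_lt_eq_zero {E : ℕ → Set ℕ} {k : ℕ}
    (h : ∀ i < k, upperDensity (E i) = 0) : upperDensity {n | ∃ i < k, n ∈ E i} = 0 :=
  upperDensity_eq_zero_iff_le.2
    ((upperDensity_exists_lt_le fun i hi => (h i hi).le).trans (by simp))

lemma upperDensity_preimage_add_le (E : Set ℕ) (k : ℕ) :
    upperDensity {n | n + k ∈ E} ≤ upperDensity E := by
  rw [upperDensity_le_iff]
  intro ε hε
  have : ∀ᶠ n : ℕ in atTop, k / (ε / 2) ≤ n := tendsto_natCast_atTop_atTop.eventually_ge_atTop _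
  filter_upwards [this,
    upperDensity_le_iff.1 (le_refl (upperDensity E)) (ε / 2) (by positivity)] with n hk hn
  rw [div_le_iff₀ (by positivity)] at hk
  have h1 := countBelow_add E k n
  have h2 := countBelow_add_le E n k
  rw [add_comm n k] at h2
  have h3 : {n | n + k ∈ E} = {i | k + i ∈ E} := by simp only [add_comm]
  have h4 : (countBelow {n | n + k ∈ E} n : ℝ) ≤ countBelow E n + k := by
    rw [h3]
    exact_mod_cast (by omega : countBelow {i | k + i ∈ E} n ≤ countBelow E n + k)
  linarith

lemma upperDensity_image_add_le (E : Set ℕ) (k : ℕ) :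
    upperDensity {n | k ≤ n ∧ n - k ∈ E} ≤ upperDensity E := by
  rw [upperDensity_le_iff]
  intro ε hε
  filter_upwards [eventually_ge_atTop k,
    upperDensity_le_iff.1 (le_refl (upperDensity E)) ε hε] with n hk hn
  refine le_trans ?_ hn
  obtain ⟨b, rfl⟩ := Nat.exists_eq_add_of_le hk
  have h1 := countBelow_add {n | k ≤ n ∧ n - k ∈ E} k b
  have h2 : countBelow {n | k ≤ n ∧ n - k ∈ E} k ≤ countBelow ∅ k :=
    countBelow_le_of_forall fun i hi h => by simp at h; omega
  have h3 : countBelow ∅ k = 0 := by simp [countBelow]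
  have h4 : {i | k + i ∈ {n | k ≤ n ∧ n - k ∈ E}} = E := by ext; simp
  rw [h4] at h1
  have h5 := countBelow_mono E (Nat.le_add_left b k)
  exact_mod_cast (by omega : countBelow {n | k ≤ n ∧ n - k ∈ E} (k + b) ≤ countBelow E (k + b))

lemma upperDensity_window_le (E : Set ℕ) (k : ℕ) :
    upperDensity {n | ∃ i < k, n + i ∈ E} ≤ k * upperDensity E :=
  upperDensity_exists_lt_le (E := fun i => {n | n + i ∈ E})
    fun i _ => upperDensity_preimage_add_le E i

lemma upperDensity_eq_zero_iff_tendsto {E : Set ℕ} :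
    upperDensity E = 0 ↔ Tendsto (fun n : ℕ => (countBelow E n : ℝ) / n) atTop (𝓝 0) := by
  constructor
  · intro h
    refine tendsto_of_le_liminf_of_limsup_le ?_ h.le (isBoundedUnder_of ⟨1, countBelow_div_le_one E⟩)
      (isBoundedUnder_of ⟨0, fun n => by positivity⟩)
    refine le_liminf_of_le ?_ (Eventually.of_forall fun n => by positivity)
    exact (isBoundedUnder_of ⟨1, countBelow_div_le_one E⟩ :
      IsBoundedUnder (· ≤ ·) atTop _).isCoboundedUnder_ge
  · exact fun h => h.limsup_eq

lemma hasDensity_one_iff {E : Set ℕ} : HasDensity E 1 ↔ upperDensity Eᶜ = 0 := by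
  have h : (fun n : ℕ => (countBelow E n : ℝ) / n) =ᶠ[atTop]
      fun n : ℕ => 1 - (countBelow Eᶜ n : ℝ) / n := by
    filter_upwards [eventually_gt_atTop 0] with n hn
    have h1 : (countBelow E n : ℝ) + countBelow Eᶜ n = n := by
      exact_mod_cast countBelow_add_compl E n
    have : (n : ℝ) ≠ 0 := by exact_mod_cast hn.ne'
    field_simp
    linarith
  rw [upperDensity_eq_zero_iff_tendsto]
  constructor
  · rintro ⟨h1, h2⟩
    have h3 : Tendsto (fun n : ℕ => (countBelow E n : ℝ) / n) atTop (𝓝 1) :=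
      tendsto_of_liminf_eq_limsup h2 h1 (isBoundedUnder_of ⟨1, countBelow_div_le_one E⟩)
        (isBoundedUnder_of ⟨0, fun n => by positivity⟩)
    simpa using (h3.congr' h).const_sub 1
  · intro h1
    have h3 : Tendsto (fun n : ℕ => (countBelow E n : ℝ) / n) atTop (𝓝 1) := by
      have := h1.const_sub 1
      rw [sub_zero] at this
      exact this.congr' h.symm
    exact ⟨h3.limsup_eq, h3.liminf_eq⟩

/-- Markov's inequality in one direction; in the other, terms below `ε / 2` contribute at most `n *
(ε / 2)` and each of the rare remaining ones at most `1`. -/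
lemma limsup_average_eq_zero_iff {f : ℕ → ℝ} (h0 : ∀ n, 0 ≤ f n) (h1 : ∀ n, f n ≤ 1) :
    limsup (fun n : ℕ => (1 / (n : ℝ)) * ∑ i ∈ Finset.range n, f i) atTop = 0 ↔
      ∀ ε > 0, upperDensity {n | ε ≤ f n} = 0 := by
  classical
  have hs0 : ∀ n, 0 ≤ ∑ i ∈ Finset.range n, f i := fun n => Finset.sum_nonneg fun i _ => h0 i
  have hs1 : ∀ n : ℕ, ∑ i ∈ Finset.range n, f i ≤ n := fun n => by
    simpa using Finset.sum_le_card_nsmul (Finset.range n) f 1 fun i _ => h1 i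
  have hcount : ∀ ε n, (countBelow {n | ε ≤ f n} n : ℝ) =
      ∑ i ∈ Finset.range n, if ε ≤ f i then 1 else 0 := by
    intro ε n
    rw [Finset.sum_boole, countBelow, ← Set.ncard_coe_finset]
    congr 2
    ext i
    simp [and_comm]
  have hform : (fun n : ℕ => (1 / (n : ℝ)) * ∑ i ∈ Finset.range n, f i) =
      fun n : ℕ => (∑ i ∈ Finset.range n, f i) / n := by
    ext n; ring
  rw [hform]
  have hnn : 0 ≤ limsup (fun n : ℕ => (∑ i ∈ Finset.range n, f i) / n) atTop :=
    limsup_nonneg (fun n => div_nonneg (hs0 n) n.cast_nonneg)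
      (fun n => div_le_one_of_le₀ (hs1 n) n.cast_nonneg)
  rw [← hnn.ge_iff_eq', limsup_average_le_iff hs0 hs1]
  constructor
  · intro h ε hε
    rw [upperDensity_eq_zero_iff_le, upperDensity_le_iff]
    intro δ hδ
    filter_upwards [h (ε * δ) (by positivity)] with n hn
    have : ε * (countBelow {n | ε ≤ f n} n : ℝ) ≤ ∑ i ∈ Finset.range n, f i := by
      rw [hcount, Finset.mul_sum]
      refine Finset.sum_le_sum fun i _ => ?_
      split_ifs with hi
      · simpa using hi
      · simpa using h0 i
    have h2 : ε * (countBelow {n | ε ≤ f n} n : ℝ) ≤ ε * ((0 + δ) * n) := by linarith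
    exact le_of_mul_le_mul_left h2 hε
  · intro h ε hε
    filter_upwards [upperDensity_le_iff.1 (h (ε / 2) (by positivity)).le (ε / 2) (by positivity)]
      with n hn
    have : ∑ i ∈ Finset.range n, f i ≤ n * (ε / 2) + countBelow {n | ε / 2 ≤ f n} n := by
      rw [hcount]
      have h2 : (n : ℝ) * (ε / 2) = ∑ i ∈ Finset.range n, ε / 2 := by simp
      rw [h2, ← Finset.sum_add_distrib]
      refine Finset.sum_le_sum fun i _ => ?_
      split_ifs with hi
      · linarith [h1 i]
      · linarith
    linarith

lemma upperDensity_range_eq_zero {t : ℕ → ℕ} (ht : ∀ m, m * m ≤ t m) :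
    upperDensity (Set.range t) = 0 := by
  rw [upperDensity_eq_zero_iff_le, upperDensity_le_iff]
  intro ε hε
  have h1 : ∀ n, countBelow (Set.range t) n ≤ Nat.sqrt n + 1 := by
    intro n
    have h : Set.range t ∩ Set.Ico 0 n ⊆ ((Finset.range (Nat.sqrt n + 1)).image t : Finset ℕ) := by
      rintro _ ⟨⟨m, rfl⟩, hm⟩
      simp only [Set.mem_Ico] at hm
      have : m ≤ Nat.sqrt n := Nat.le_sqrt.2 ((ht m).trans hm.2.le)
      simp only [Finset.coe_image, Set.mem_image, Finset.mem_coe, Finset.mem_range]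
      exact ⟨m, by omega, rfl⟩
    refine (Set.ncard_le_ncard h (Finset.finite_toSet _)).trans ?_
    rw [Set.ncard_coe_finset]
    exact Finset.card_image_le.trans (by simp)
  -- Once `√n ≥ 2 / ε` and `√n ≥ 1`, one has `√n + 1 ≤ 2 √n ≤ ε n`.
  obtain ⟨K, hK⟩ := exists_nat_gt (2 / ε)
  filter_upwards [eventually_ge_atTop ((K + 1) * (K + 1))] with n hn
  have h2 : K + 1 ≤ Nat.sqrt n := Nat.le_sqrt.2 hn
  have h3 : ((Nat.sqrt n * Nat.sqrt n : ℕ) : ℝ) ≤ n := by exact_mod_cast Nat.sqrt_le n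
  have h4 : (countBelow (Set.range t) n : ℝ) ≤ Nat.sqrt n + 1 := by exact_mod_cast h1 n
  have h5 : (K : ℝ) + 1 ≤ Nat.sqrt n := by exact_mod_cast h2
  have h6 : 2 < K * ε := by rwa [div_lt_iff₀ hε] at hK
  push_cast at h3
  have h7 : (2 : ℝ) ≤ ε * Nat.sqrt n := by nlinarith
  have h8 : (1 : ℝ) ≤ Nat.sqrt n := by linarith [K.cast_nonneg (α := ℝ)]
  nlinarith

/-! ### Gluing along a sequence of times -/

/-- The index `m` with `t m ≤ n < t (m + 1)`, for a strictly increasing `t` with `t 0 = 0`. -/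
def stage (t : ℕ → ℕ) (n : ℕ) : ℕ := Nat.findGreatest (fun m => t m ≤ n) n

lemma stage_spec {t : ℕ → ℕ} (h0 : t 0 = 0) (ht : StrictMono t) (n : ℕ) :
    t (stage t n) ≤ n ∧ n < t (stage t n + 1) := by
  refine ⟨Nat.findGreatest_spec (P := fun m => t m ≤ n) (Nat.zero_le n) (by simp [h0]), ?_⟩
  by_contra! h
  have h1 : stage t n + 1 ≤ n := (ht.le_apply).trans h
  exact Nat.findGreatest_is_greatest (P := fun m => t m ≤ n) (Nat.lt_succ_self _) h1 h

lemma stage_eq {t : ℕ → ℕ} (h0 : t 0 = 0) (ht : StrictMono t) {m n : ℕ} (h1 : t m ≤ n)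
    (h2 : n < t (m + 1)) : stage t n = m := by
  have h := stage_spec h0 ht n
  have h3 := ht.lt_iff_lt.1 (h1.trans_lt h.2)
  have h4 := ht.lt_iff_lt.1 (h.1.trans_lt h2)
  omega

/-- Since the times at least double, the contributions of the completed stages sum geometrically to
at most `2 * c * t m`; the current stage adds `c * n`. The first `k` stages cost only a constant. -/
lemma upperDensity_glue_le {t : ℕ → ℕ} (h0 : t 0 = 0) (ht : StrictMono t)
    (hdouble : ∀ m, 2 * t m ≤ t (m + 1)) {E : ℕ → Set ℕ} {c : ℝ} (hc : 0 ≤ c) {k : ℕ}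
    (hE : ∀ m ≥ k, ∀ n ≥ t m, (countBelow (E m) n : ℝ) ≤ c * n) :
    upperDensity {n | n ∈ E (stage t n)} ≤ 3 * c := by
  set F := {n | n ∈ E (stage t n)} with hF
  have key : ∀ m ≥ k, ∀ n, t m ≤ n → n ≤ t (m + 1) →
      (countBelow F n : ℝ) ≤ countBelow F (t m) + c * n := by
    intro m hm n h1 h2
    have h3 : countBelow F n ≤ countBelow F (t m) + countBelow (E m) n := by
      obtain ⟨b, rfl⟩ := Nat.exists_eq_add_of_le h1
      rw [countBelow_add, countBelow_add (E m)]
      have : countBelow {i | t m + i ∈ F} b ≤ countBelow {i | t m + i ∈ E m} b := by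
        refine countBelow_le_of_forall fun i hi h => ?_
        have : stage t (t m + i) = m := stage_eq h0 ht (by omega) (by omega)
        simpa [hF, this] using h
      omega
    have h4 : (countBelow F n : ℝ) ≤ countBelow F (t m) + countBelow (E m) n := by
      exact_mod_cast h3
    linarith [hE m hm n h1]
  have step : ∀ m ≥ k, (countBelow F (t m) : ℝ) ≤ t k + 2 * c * t m := by
    intro m hm
    induction m, hm using Nat.le_induction with
    | base =>
      have : (countBelow F (t k) : ℝ) ≤ t k := by exact_mod_cast countBelow_le _ _
      have : 0 ≤ 2 * c * t k := by positivity
      linarith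
    | succ m hm ih =>
      have h1 := key m hm (t (m + 1)) (ht (Nat.lt_succ_self m)).le le_rfl
      have h2 : 2 * (t m : ℝ) ≤ t (m + 1) := by exact_mod_cast hdouble m
      nlinarith
  refine upperDensity_le_of_forall (C := t k) fun n => ?_
  rcases lt_or_ge n (t k) with hn | hn
  · have h1 : (countBelow F n : ℝ) ≤ n := by exact_mod_cast countBelow_le _ _
    have h2 : (n : ℝ) ≤ t k := by exact_mod_cast hn.le
    have : 0 ≤ 3 * c * n := by positivity
    linarith
  · obtain ⟨h1, h2⟩ := stage_spec h0 ht n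
    have hk : k ≤ stage t n := by
      have := ht.lt_iff_lt.1 (hn.trans_lt h2)
      omega
    have h3 := key _ hk n h1 h2.le
    have h4 := step _ hk
    have h5 : (t (stage t n) : ℝ) ≤ n := by exact_mod_cast h1
    nlinarith

/-- Rapidly increasing times, determined by lower bounds `a`. -/
def rapidTimes (a : ℕ → ℕ) : ℕ → ℕ
  | 0 => 0
  | m + 1 => (m + 2) * rapidTimes a m + a m + (m + 1) * (m + 1)

/-- `E m k` is the error of the `m`-th object in the `k`-th test. Each stage begins only when the
finitely many tests `k ≤ m` have reached their density bounds. The growth `m * m ≤ t m` makes the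
switching times a null set, and `b` leaves room for further demands. -/
lemma exists_times (b : ℕ → ℕ) {E : ℕ → ℕ → Set ℕ} {c : ℕ → ℝ} (hc : ∀ k, 0 ≤ c k)
    (h : ∀ m, ∀ k ≤ m, upperDensity (E m k) < c k) :
    ∃ t : ℕ → ℕ, t 0 = 0 ∧ StrictMono t ∧ (∀ m, m * m ≤ t m) ∧
      (∀ m, (m + 2) * t m + b m ≤ t (m + 1)) ∧
      ∀ k, upperDensity {n | n ∈ E (stage t n) k} ≤ 3 * c k := by
  have hth : ∀ m, ∃ a, ∀ k ≤ m, ∀ n ≥ a, (countBelow (E m k) n : ℝ) ≤ c k * n := by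
    intro m
    have h1 : ∀ᶠ n : ℕ in atTop, ∀ k ∈ Finset.range (m + 1),
        (countBelow (E m k) n : ℝ) ≤ c k * n := by
      rw [Filter.eventually_all_finset]
      intro k hk
      exact eventually_countBelow_le (h m k (by simpa [Nat.lt_succ_iff] using hk))
    obtain ⟨a, ha⟩ := eventually_atTop.1 h1
    exact ⟨a, fun k hk n hn => ha n hn k (by simpa [Nat.lt_succ_iff] using hk)⟩
  choose a ha using hth
  set t := rapidTimes (fun m => a (m + 1) + b m) with ht
  have hsucc : ∀ m, t (m + 1) = (m + 2) * t m + (a (m + 1) + b m) + (m + 1) * (m + 1) :=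
    fun m => rfl
  have hdouble : ∀ m, 2 * t m ≤ t (m + 1) := fun m => by rw [hsucc]; nlinarith [Nat.zero_le (t m)]
  have hmono : StrictMono t := strictMono_nat_of_lt_succ fun m => by rw [hsucc]; nlinarith
  refine ⟨t, rfl, hmono, ?_, fun m => by rw [hsucc]; nlinarith, fun k => ?_⟩
  · rintro (_ | m)
    · simp
    · rw [hsucc]; omega
  -- Stage `0` is skipped: `t 0 = 0` cannot exceed a threshold.
  · refine upperDensity_glue_le (k := k + 1) rfl hmono hdouble (E := fun m => E m k) (hc k) ?_
    intro m hm n hn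
    obtain ⟨m, rfl⟩ : ∃ m', m = m' + 1 := ⟨m - 1, by omega⟩
    exact ha (m + 1) k (by omega) n (le_trans (by rw [hsucc]; nlinarith) hn)

/-! ### The pseudometric `d̄` and windows in the language -/

section Words

variable {A : Type*}

lemma dbar_nonneg (x y : ℕ → A) : 0 ≤ dbar x y := upperDensity_nonneg _

lemma dbar_comm (x y : ℕ → A) : dbar x y = dbar y x := by simp only [dbar, ne_comm]

lemma dbar_triangle (x y z : ℕ → A) : dbar x z ≤ dbar x y + dbar y z := by
  refine (upperDensity_mono fun n hn => ?_).trans (upperDensity_union_le _ _)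
  by_contra h
  simp only [Set.mem_union, Set.mem_ofPred_eq, not_or, not_not] at h hn
  exact hn (h.1.trans h.2)

variable [TopologicalSpace A]

lemma shift_mem (X : Subshift A ℕ) {x : ℕ → A} (hx : x ∈ X.carrier) (a : ℕ) :
    (fun i => x (a + i)) ∈ X.carrier := X.mapsTo a hx

lemma shiftMap_apply (X : Subshift A ℕ) (x : X.carrier) (i : ℕ) :
    (shiftMap X x : ℕ → A) i = (x : ℕ → A) (i + 1) :=
  congrArg (x : ℕ → A) (Nat.add_comm 1 i)

lemma iterate_shiftMap_apply (X : Subshift A ℕ) (x : X.carrier) (n i : ℕ) :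
    ((shiftMap X)^[n] x : ℕ → A) i = (x : ℕ → A) (n + i) := by
  induction n generalizing i with
  | zero => simp
  | succ n ih =>
    rw [Function.iterate_succ_apply', shiftMap_apply, ih]
    exact congrArg (x : ℕ → A) (by omega)

/-- The word `f a, …, f (a + k - 1)` belongs to the language of `X`. -/
def InLanguage (X : Subshift A ℕ) (f : ℕ → A) (a k : ℕ) : Prop :=
  ∃ x ∈ X.carrier, ∀ i < k, x i = f (a + i)

lemma InLanguage.subword {X : Subshift A ℕ} {f : ℕ → A} {a k b l : ℕ} (h : InLanguage X f a k)
    (h1 : a ≤ b) (h2 : b + l ≤ a + k) : InLanguage X f b l := by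
  obtain ⟨x, hx, hxf⟩ := h
  refine ⟨_, shift_mem X hx (b - a), fun i hi => ?_⟩
  rw [hxf _ (by omega)]
  refine congrArg f ?_
  omega

lemma InLanguage.congr {X : Subshift A ℕ} {f g : ℕ → A} {a b k : ℕ} (h : InLanguage X f a k)
    (hfg : ∀ i < k, f (a + i) = g (b + i)) : InLanguage X g b k := by
  obtain ⟨x, hx, hxf⟩ := h
  exact ⟨x, hx, fun i hi => (hxf i hi).trans (hfg i hi)⟩

lemma inLanguage_of_mem {X : Subshift A ℕ} {x : ℕ → A} (hx : x ∈ X.carrier) (a k : ℕ) :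
    InLanguage X x a k := ⟨_, shift_mem X hx a, fun _ _ => rfl⟩

lemma inLanguage_zero {X : Subshift A ℕ} (hne : X.carrier.Nonempty) (f : ℕ → A) (a : ℕ) :
    InLanguage X f a 0 := ⟨hne.some, hne.some_mem, by simp⟩

/-- Sequences in which, for every `k`, almost all windows of length `k` are in the language. -/
def AlmostInLanguage (X : Subshift A ℕ) (y : ℕ → A) : Prop :=
  ∀ k, upperDensity {n | ¬ InLanguage X y n k} = 0

/-- Every sequence with almost all windows in the language is at `d̄`-distance zero from `X`. -/
def TracesAlmostInLanguage (X : Subshift A ℕ) : Prop :=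
  ∀ y, AlmostInLanguage X y → ∃ z ∈ X.carrier, dbar z y = 0

/-- A window outside the language must meet `J`, and the windows of fixed length meeting a null set
start at a null set. -/
lemma almostInLanguage_of_cuts {X : Subshift A ℕ} {y : ℕ → A} {J : Set ℕ}
    (hJ : upperDensity J = 0)
    (h : ∀ n k, (∀ i < k, n + i ∉ J) → InLanguage X y n k) : AlmostInLanguage X y := by
  intro k
  refine upperDensity_eq_zero_of_subset (F := {n | ∃ i < k, n + i ∈ J}) ?_ ?_
  · intro n hn
    by_contra h1
    simp only [Set.mem_ofPred_eq, not_exists, not_and] at h1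
    exact hn (h n k h1)
  · exact upperDensity_eq_zero_iff_le.2 ((upperDensity_window_le J k).trans (by simp [hJ]))

/-! ### From pseudo-orbits of points to sequences of letters -/

lemma continuous_shiftMap (X : Subshift A ℕ) : Continuous (shiftMap X) := by
  refine Continuous.subtype_mk ?_ _
  exact continuous_pi fun i => (continuous_apply (1 + i)).comp continuous_subtype_val

/-- Following the pseudo-orbit for `j` steps adds up `j` one-step errors, each on a translate of a
null set. -/
lemma upperDensity_orbit_window_eq_zero {X : Subshift A ℕ} {x : ℕ → X.carrier}
    (h : ∀ k, upperDensity {n | ∃ i < k, (x n : ℕ → A) (i + 1) ≠ (x (n + 1) : ℕ → A) i} = 0)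
    (j i : ℕ) : upperDensity {n | (x n : ℕ → A) (j + i) ≠ (x (n + j) : ℕ → A) i} = 0 := by
  induction j generalizing i with
  | zero => simp [upperDensity_empty]
  | succ j ih =>
    refine upperDensity_eq_zero_of_subset (F := {n | (x n : ℕ → A) (j + (i + 1)) ≠
      (x (n + j) : ℕ → A) (i + 1)} ∪ {n | n + j ∈
        {n | ∃ i' < i + 1, (x n : ℕ → A) (i' + 1) ≠ (x (n + 1) : ℕ → A) i'}}) ?_ ?_
    · intro n hn
      by_contra hcon
      simp only [Set.mem_union, Set.mem_ofPred_eq, not_or, not_not, not_exists, not_and] at hcon hn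
      apply hn
      rw [show j + 1 + i = j + (i + 1) by omega, hcon.1, hcon.2 i (by omega),
        show n + j + 1 = n + (j + 1) by omega]
    · exact upperDensity_union_eq_zero (ih _)
        (upperDensity_eq_zero_iff_le.2 ((upperDensity_preimage_add_le _ j).trans (h _).le))

/-- Tracing of pseudo-orbits, in terms of the letters seen in finite windows. -/
def TracesWindows (X : Subshift A ℕ) : Prop :=
  ∀ x : ℕ → X.carrier,
    (∀ k, upperDensity {n | ∃ i < k, (x n : ℕ → A) (i + 1) ≠ (x (n + 1) : ℕ → A) i} = 0) →
      ∃ z : X.carrier, ∀ k, upperDensity {n | ∃ i < k, (z : ℕ → A) (n + i) ≠ (x n : ℕ → A) i} = 0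

-- The pseudo-orbit consists of points `x n` beginning with the longest admissible word that `y`
-- shows from position `n` on. Where `y` has a good window of length `k + 1`, both `x n` and `x (n +
-- 1)` copy `y` there, so they are compatible.
open Classical in
lemma TracesWindows.tracesAlmostInLanguage {X : Subshift A ℕ} (hne : X.carrier.Nonempty)
    (h : TracesWindows X) : TracesAlmostInLanguage X := by
  intro y hy
  -- The cap `n` ensures that a longest word exists; for a fixed window length it matters only for
  -- finitely many `n`.
  set len : ℕ → ℕ := fun n => Nat.findGreatest (InLanguage X y n) n with hlen
  have hx : ∀ n, ∃ x : X.carrier, ∀ i < len n, (x : ℕ → A) i = y (n + i) := by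
    intro n
    obtain ⟨x, hx, h⟩ : InLanguage X y n (len n) :=
      Nat.findGreatest_spec (P := InLanguage X y n) (Nat.zero_le n) (inLanguage_zero hne y n)
    exact ⟨⟨x, hx⟩, h⟩
  choose x hx using hx
  have hle : ∀ {n k}, k ≤ n → InLanguage X y n k → k ≤ len n :=
    fun hkn hk => Nat.le_findGreatest hkn hk
  have hx0 : ∀ {n i k}, i < k → k ≤ n → InLanguage X y n k → (x n : ℕ → A) i = y (n + i) :=
    fun hi hkn hk => hx _ _ (lt_of_lt_of_le hi (hle hkn hk))
  obtain ⟨z, hz⟩ := h x fun k => by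
    refine upperDensity_eq_zero_of_subset
      (F := {n | n < k + 1} ∪ {n | ¬ InLanguage X y n (k + 1)}) ?_
      (upperDensity_union_eq_zero (upperDensity_setOf_lt _) (hy _))
    rintro n ⟨i, hi, hn⟩
    by_contra hcon
    simp only [Set.mem_union, Set.mem_ofPred_eq, not_or, not_not, not_lt] at hcon
    apply hn
    rw [hx0 (show i + 1 < k + 1 by omega) hcon.1 hcon.2,
      hx0 hi (by omega) (hcon.2.subword (by omega) (by omega))]
    congr 1
    omega
  refine ⟨z, z.2, upperDensity_eq_zero_of_subset (F := {n | ∃ i < 1, (z : ℕ → A) (n + i) ≠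
    (x n : ℕ → A) i} ∪ ({n | n < 1} ∪ {n | ¬ InLanguage X y n 1})) ?_
    (upperDensity_union_eq_zero (hz 1)
      (upperDensity_union_eq_zero (upperDensity_setOf_lt _) (hy _)))⟩
  intro n hn
  by_contra hcon
  simp only [Set.mem_union, Set.mem_ofPred_eq, not_or, not_not, not_lt, not_exists, not_and]
    at hcon
  have h1 := hcon.1 0 one_pos
  rw [hx0 one_pos hcon.2.1 hcon.2.2] at h1
  exact hn h1

/-- The sequence to trace is that of the zeroth letters of the points `x n`: for most `n` its window
at `n` is a prefix of `x n`. -/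
lemma TracesAlmostInLanguage.tracesWindows {X : Subshift A ℕ}
    (h : TracesAlmostInLanguage X) : TracesWindows X := by
  intro x hx
  have hwin : ∀ k, upperDensity {n | ∃ i < k, n ∈ {n | (x n : ℕ → A) i ≠
      (x (n + i) : ℕ → A) 0}} = 0 := fun k =>
    upperDensity_exists_lt_eq_zero fun i _ => upperDensity_orbit_window_eq_zero hx i 0
  obtain ⟨z, hz, hzy⟩ := h (fun n => (x n : ℕ → A) 0) fun k => by
    refine upperDensity_eq_zero_of_subset ?_ (hwin k)
    intro n hn
    by_contra hcon
    simp only [Set.mem_ofPred_eq, not_exists, not_and, not_not] at hcon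
    exact hn ⟨x n, (x n).2, hcon⟩
  refine ⟨⟨z, hz⟩, fun k => ?_⟩
  have h1 : upperDensity {n | ∃ i < k, n + i ∈ {n | z n ≠ (x n : ℕ → A) 0}} = 0 :=
    upperDensity_eq_zero_iff_le.2 ((upperDensity_window_le _ k).trans
      (by rw [show upperDensity {n | z n ≠ (x n : ℕ → A) 0} = 0 from hzy, mul_zero]))
  refine upperDensity_eq_zero_of_subset ?_ (upperDensity_union_eq_zero h1 (hwin k))
  rintro n ⟨i, hi, hn⟩
  by_contra hcon
  simp only [Set.mem_union, Set.mem_ofPred_eq, not_or, not_not, not_exists, not_and] at hcon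
  exact hn ((hcon.1 i hi).trans (hcon.2 i hi).symm)

lemma tracesWindows_iff {X : Subshift A ℕ} (hne : X.carrier.Nonempty) :
    TracesWindows X ↔ TracesAlmostInLanguage X :=
  ⟨fun h => h.tracesAlmostInLanguage hne, fun h => h.tracesWindows⟩

/-! ### Translation of the tracing properties -/

lemma forall_upperDensity_le_dist_iff {X : Set (ℕ → A)} [DiscreteTopology A] (u v : ℕ → X) :
    (∀ ε > 0, upperDensity {n | ε ≤ dist (u n) (v n)} = 0) ↔
      ∀ k, upperDensity {n | ∃ i < k, (u n : ℕ → A) i ≠ (v n : ℕ → A) i} = 0 := by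
  constructor
  · intro h k
    refine upperDensity_eq_zero_of_subset ?_ (h ((1 / 2) ^ k) (by positivity))
    rintro n ⟨i, hi, hne⟩
    by_contra hlt
    simp only [Set.mem_ofPred_eq, not_le] at hlt
    exact hne (PiNat.apply_eq_of_dist_lt hlt hi.le)
  · intro h ε hε
    obtain ⟨k, hk⟩ := exists_pow_lt_of_lt_one hε (by norm_num : (1 / 2 : ℝ) < 1)
    refine upperDensity_eq_zero_of_subset ?_ (h k)
    intro n hn
    by_contra hcon
    simp only [Set.mem_ofPred_eq, not_exists, not_and, not_not] at hcon hn
    have : dist (u n : ℕ → A) (v n) ≤ (1 / 2) ^ k :=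
      PiNat.mem_cylinder_iff_dist_le.1 fun i hi => hcon i hi
    exact absurd (hn.trans this) (not_le.2 hk)

variable [DiscreteTopology A]

lemma isAsymptoticAveragePseudoOrbit_iff_forall_dist {X : Subshift A ℕ} (x : ℕ → X.carrier) :
    IsAsymptoticAveragePseudoOrbit (shiftMap X) x ↔
      ∀ ε > 0, upperDensity {n | ε ≤ dist (shiftMap X (x n)) (x (n + 1))} = 0 :=
  limsup_average_eq_zero_iff (fun _ => dist_nonneg) (fun _ => PiNat.dist_le_one _ _)

lemma isAsymptoticAveragePseudoOrbit_iff {X : Subshift A ℕ} (x : ℕ → X.carrier) :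
    IsAsymptoticAveragePseudoOrbit (shiftMap X) x ↔
      ∀ k, upperDensity {n | ∃ i < k, (x n : ℕ → A) (i + 1) ≠ (x (n + 1) : ℕ → A) i} = 0 := by
  rw [isAsymptoticAveragePseudoOrbit_iff_forall_dist,
    forall_upperDensity_le_dist_iff (fun n => shiftMap X (x n)) (fun n => x (n + 1))]
  simp only [shiftMap_apply]

lemma forall_upperDensity_le_dist_orbit_iff {X : Subshift A ℕ} (z : X.carrier)
    (x : ℕ → X.carrier) :
    (∀ ε > 0, upperDensity {n | ε ≤ dist ((shiftMap X)^[n] z) (x n)} = 0) ↔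
      ∀ k, upperDensity {n | ∃ i < k, (z : ℕ → A) (n + i) ≠ (x n : ℕ → A) i} = 0 := by
  rw [forall_upperDensity_le_dist_iff (fun n => (shiftMap X)^[n] z) x]
  simp only [iterate_shiftMap_apply]

lemma besicovitch_orbitSeq_eq_zero_iff {X : Subshift A ℕ} (z : X.carrier) (x : ℕ → X.carrier) :
    besicovitch (orbitSeq (shiftMap X) z) x = 0 ↔
      ∀ k, upperDensity {n | ∃ i < k, (z : ℕ → A) (n + i) ≠ (x n : ℕ → A) i} = 0 := by
  rw [← forall_upperDensity_le_dist_orbit_iff]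
  exact limsup_average_eq_zero_iff (fun _ => dist_nonneg) (fun _ => PiNat.dist_le_one _ _)

lemma forall_hasDensity_dist_orbit_iff {X : Subshift A ℕ} (z : X.carrier) (x : ℕ → X.carrier) :
    (∀ ε : ℝ, 0 < ε → HasDensity {n : ℕ | dist ((shiftMap X)^[n] z) (x n) < ε} 1) ↔
      ∀ k, upperDensity {n | ∃ i < k, (z : ℕ → A) (n + i) ≠ (x n : ℕ → A) i} = 0 := by
  rw [← forall_upperDensity_le_dist_orbit_iff]
  refine forall₂_congr fun ε _ => ?_
  rw [hasDensity_one_iff, Set.compl_ofPred]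
  simp only [not_lt]

/-- By compactness, `U` contains a uniform neighbourhood of the set of orbits: if `y K` were a
counterexample for each `K`, then along a subsequence with `y K 0` converging to `w` the sequences
`y K` would converge to the orbit of `w`, which lies in `U`. -/
lemma exists_forall_mem_of_isOpen [Finite A] {X : Subshift A ℕ} {U : Set (ℕ → X.carrier)}
    (hU : @IsOpen _ Pi.topologicalSpace U) (hUX : Set.range (orbitSeq (shiftMap X)) ⊆ U) :
    ∃ K, ∀ y : ℕ → X.carrier,
      (∀ k < K, ∀ i < K, (y k : ℕ → A) i = (y 0 : ℕ → A) (k + i)) → y ∈ U := by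
  by_contra! hcon
  choose y hy hyU using hcon
  have : CompactSpace X.carrier := isCompact_iff_compactSpace.1 X.isClosed.isCompact
  obtain ⟨w, -, φ, hφ, hw⟩ := isCompact_univ.tendsto_subseq (x := fun K => y K 0)
    fun _ => Set.mem_univ _
  have hcoord : ∀ i, ∀ᶠ K in atTop, (y (φ K) 0 : ℕ → A) i = (w : ℕ → A) i := by
    intro i
    have h1 : Tendsto (fun K => (y (φ K) 0 : ℕ → A) i) atTop (𝓝 ((w : ℕ → A) i)) :=
      ((continuous_apply i).comp continuous_subtype_val).continuousAt.tendsto.comp hw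
    rw [nhds_discrete] at h1
    exact tendsto_pure.1 h1
  have hlim : @Tendsto _ (ℕ → X.carrier) (fun K => y (φ K)) atTop
      (@nhds _ Pi.topologicalSpace (orbitSeq (shiftMap X) w)) := by
    rw [tendsto_pi_nhds]
    intro k
    rw [tendsto_subtype_rng, tendsto_pi_nhds]
    intro i
    refine tendsto_const_nhds.congr' ?_
    filter_upwards [hcoord (k + i), eventually_gt_atTop (k + i)] with K h1 h2
    have h3 := hφ.le_apply (x := K)
    rw [hy (φ K) k (by omega) i (by omega), h1]
    exact iterate_shiftMap_apply X w k i
  have hmem : U ∈ @nhds _ Pi.topologicalSpace (orbitSeq (shiftMap X) w) :=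
    IsOpen.mem_nhds hU (hUX ⟨w, rfl⟩)
  have hev : ∀ᶠ K in atTop, y (φ K) ∈ U := hlim hmem
  obtain ⟨K, hK⟩ := hev.exists
  exact hyU _ hK

lemma isVaguePseudoOrbit_iff [Finite A] {X : Subshift A ℕ} (x : ℕ → X.carrier) :
    IsVaguePseudoOrbit (shiftMap X) x ↔
      ∀ k, upperDensity {n | ∃ i < k, (x n : ℕ → A) (i + 1) ≠ (x (n + 1) : ℕ → A) i} = 0 := by
  constructor
  · intro h
    rw [← isAsymptoticAveragePseudoOrbit_iff, isAsymptoticAveragePseudoOrbit_iff_forall_dist]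
    intro ε hε
    -- Testing against this one neighbourhood of the orbits already controls the one-step errors.
    have hopen : @IsOpen (ℕ → X.carrier) Pi.topologicalSpace
        {y | dist (shiftMap X (y 0)) (y 1) < ε} := by
      have h0 : @Continuous (ℕ → X.carrier) _ Pi.topologicalSpace _
          fun y => dist (shiftMap X (y 0)) (y 1) :=
        ((continuous_shiftMap X).comp (continuous_apply 0)).dist (continuous_apply 1)
      exact @IsOpen.preimage _ _ Pi.topologicalSpace _ _ h0 _ isOpen_Iio
    have h1 := h _ hopen (by rintro _ ⟨z, rfl⟩; simpa [orbitSeq] using hε)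
    rw [hasDensity_one_iff, Set.compl_ofPred] at h1
    simpa using h1
  · intro h U hU hUX
    obtain ⟨K, hK⟩ := exists_forall_mem_of_isOpen hU hUX
    rw [hasDensity_one_iff]
    refine upperDensity_eq_zero_of_subset (F := {n | ∃ k < K, n ∈ {n | ∃ i < K,
      n ∈ {n | (x n : ℕ → A) (k + i) ≠ (x (n + k) : ℕ → A) i}}}) ?_ ?_
    · intro n hn
      by_contra hcon
      simp only [Set.mem_ofPred_eq, not_exists, not_and, not_not] at hcon
      exact hn (hK _ fun k hk i hi => (hcon k hk i hi).symm)
    · exact upperDensity_exists_lt_eq_zero fun k _ => upperDensity_exists_lt_eq_zero fun i _ =>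
        upperDensity_orbit_window_eq_zero h k i

lemma asymptoticAverageShadowing_iff_tracesWindows (X : Subshift A ℕ) :
    AsymptoticAverageShadowing (shiftMap X) ↔ TracesWindows X := by
  simp only [AsymptoticAverageShadowing, TracesWindows, isAsymptoticAveragePseudoOrbit_iff,
    besicovitch_orbitSeq_eq_zero_iff]

lemma vagueSpecification_iff_tracesWindows [Finite A] (X : Subshift A ℕ) :
    VagueSpecification (shiftMap X) ↔ TracesWindows X := by
  simp only [VagueSpecification, TracesWindows, isVaguePseudoOrbit_iff,
    forall_hasDensity_dist_orbit_iff]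

end Words

/-! ### Completeness -/

section Main

variable {A : Type*}

/-- The full shift is complete for `d̄`. -/
lemma exists_tendsto_dbar {z : ℕ → ℕ → A}
    (hz : ∀ ε : ℝ, 0 < ε → ∃ N : ℕ, ∀ n ≥ N, ∀ m ≥ N, dbar (z n) (z m) < ε) :
    ∃ y : ℕ → A, Tendsto (fun n => dbar (z n) y) atTop (𝓝 0) := by
  choose! N hN using hz
  have hpos : ∀ k : ℕ, (0 : ℝ) < 1 / (k + 1) := fun k => Nat.one_div_pos_of_nat
  set r : ℕ → ℕ := fun k => (Finset.range (k + 1)).sup fun j => N (1 / ((j : ℝ) + 1)) with hr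
  have hrN : ∀ m k : ℕ, k ≤ m → N (1 / ((k : ℝ) + 1)) ≤ r m := fun m k hk =>
    Finset.le_sup (f := fun j : ℕ => N (1 / ((j : ℝ) + 1))) (Finset.mem_range.2 (Nat.lt_succ_of_le hk))
  -- The limit follows `z (r m)` during stage `m`; for `k ≤ m` this differs from `z (r k)` with
  -- density below `1 / (k + 1)`.
  obtain ⟨t, h0, ht, -, -, hglue⟩ := exists_times (fun _ => 0)
    (E := fun m k => {i | z (r k) i ≠ z (r m) i}) (c := fun k => 1 / ((k : ℝ) + 1))
    (fun k => (hpos k).le) (fun m k hk => hN _ (hpos k) _ (hrN k k le_rfl) _ (hrN m k hk))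
  refine ⟨fun n => z (r (stage t n)) n, ?_⟩
  rw [Metric.tendsto_atTop]
  intro ε hε
  -- One quarter for the Cauchy estimate, three for the factor `3` lost in gluing.
  obtain ⟨k, hk⟩ := exists_nat_one_div_lt (show 0 < ε / 4 by positivity)
  refine ⟨r k, fun n hn => ?_⟩
  rw [Real.dist_0_eq_abs, abs_of_nonneg (dbar_nonneg _ _)]
  have h1 := dbar_triangle (z n) (z (r k)) (fun n => z (r (stage t n)) n)
  have h2 : dbar (z n) (z (r k)) < 1 / ((k : ℝ) + 1) :=
    hN _ (hpos k) _ ((hrN k k le_rfl).trans hn) _ (hrN k k le_rfl)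
  have h3 : dbar (z (r k)) (fun n => z (r (stage t n)) n) ≤ 3 * (1 / ((k : ℝ) + 1)) := hglue k
  linarith

variable [TopologicalSpace A] {X : Subshift A ℕ}

lemma upperDensity_not_inLanguage_le {x : ℕ → A} (hx : x ∈ X.carrier) (y : ℕ → A) (k : ℕ) :
    upperDensity {n | ¬ InLanguage X y n k} ≤ k * dbar x y := by
  refine (upperDensity_mono fun n hn => ?_).trans (upperDensity_window_le _ k)
  by_contra hcon
  simp only [Set.mem_ofPred_eq, not_exists, not_and, not_not] at hcon
  exact hn ((inLanguage_of_mem hx n k).congr hcon)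

/-- The limit `y` in the full shift need not lie in `X`, but its bad windows of length `k` have
density at most `k * dbar (z n) y` for every `n`, hence zero. A point tracing `y` is then also a
limit. -/
lemma TracesAlmostInLanguage.dbarComplete (h : TracesAlmostInLanguage X) : DbarComplete X := by
  intro z hzX hz
  obtain ⟨y, hy⟩ := exists_tendsto_dbar hz
  obtain ⟨x, hx, hxy⟩ := h y fun k => by
    have hk := hy.const_mul (k : ℝ)
    rw [mul_zero] at hk
    exact upperDensity_eq_zero_iff_le.2
      (ge_of_tendsto' hk fun n => upperDensity_not_inLanguage_le (hzX n) y k)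
  refine ⟨x, hx, squeeze_zero (fun n => dbar_nonneg _ _) (fun n => ?_) hy⟩
  have := dbar_triangle (z n) y x
  rw [dbar_comm y x, hxy] at this
  simpa using this

/-! ### Approximation of finite concatenations -/

lemma mul_countBelow_le_of_periodic {E : Set ℕ} {M : ℕ} {c : ℝ}
    (h : ∀ q, c ≤ countBelow {i | q * M + i ∈ E} M) (q : ℕ) :
    q * c ≤ countBelow E (q * M) := by
  induction q with
  | zero => simp
  | succ q ih =>
    rw [add_mul, one_mul, countBelow_add]
    push_cast
    linarith [h q]

lemma countBelow_le_of_periodic {E : Set ℕ} {M c : ℕ}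
    (h : ∀ q, countBelow {i | q * M + i ∈ E} M ≤ c) (q : ℕ) :
    countBelow E (q * M) ≤ q * c := by
  induction q with
  | zero => simp [countBelow]
  | succ q ih =>
    rw [add_mul, one_mul, countBelow_add, add_mul]
    linarith [h q]

/-- The cuts of the periodic repetition of a word of length `M` with cuts in `J`. -/
def periodicCuts (J : Set ℕ) (M : ℕ) : Set ℕ := {n | n % M ∈ J ∨ n % M = 0}

/-- Each period has at most `M / N` cuts from `J` and one at the junction, which is again at most `M
/ N` because `N ≤ M`. -/
lemma upperDensity_periodicCuts_le {J : Set ℕ} {M N : ℕ} (hN : 0 < N) (hNM : N ≤ M)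
    (hJ : countBelow J M * N ≤ M) : upperDensity (periodicCuts J M) ≤ 2 / N := by
  have hM : 0 < M := hN.trans_le hNM
  have hN' : (0 : ℝ) < N := by exact_mod_cast hN
  have h1 : ∀ q, countBelow {i | q * M + i ∈ periodicCuts J M} M ≤ countBelow J M + 1 := by
    intro q
    have : countBelow {i | q * M + i ∈ periodicCuts J M} M ≤ countBelow (J ∪ {i | i < 1}) M := by
      refine countBelow_le_of_forall fun i hi h => ?_
      simp only [periodicCuts, Set.mem_ofPred_eq, Nat.mul_add_mod',
        Nat.mod_eq_of_lt hi] at h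
      rcases h with h | h
      · exact Or.inl h
      · exact Or.inr (by simp [h])
    have h2 := countBelow_union_le J {i | i < 1} M
    have h3 : countBelow {i | i < 1} M ≤ 1 := by
      obtain ⟨b, rfl⟩ := Nat.exists_eq_add_of_le hM
      rw [countBelow_add]
      have h1 := countBelow_le {n | n < 1} 1
      have h2 : countBelow {i | Nat.succ 0 + i ∈ {n | n < 1}} b = 0 := by
        simp [countBelow]
      simp only [Nat.succ_eq_add_one, zero_add] at h2 ⊢
      omega
    omega
  refine upperDensity_le_of_forall (C := 2 * M / N) fun n => ?_
  have h2 : countBelow (periodicCuts J M) n ≤ (n / M + 1) * (countBelow J M + 1) :=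
    (countBelow_mono _ (by rw [add_mul, one_mul]; exact (Nat.lt_div_mul_add hM).le)).trans
      (countBelow_le_of_periodic h1 _)
  have h3 : (countBelow J M + 1) * N ≤ 2 * M := by rw [add_mul]; omega
  have h4 : (n / M + 1) * M ≤ n + M := by
    rw [add_mul, one_mul]; have := Nat.div_mul_le_self n M; omega
  have h5 : countBelow (periodicCuts J M) n * N ≤ 2 * (n + M) :=
    calc _ ≤ (n / M + 1) * (countBelow J M + 1) * N := Nat.mul_le_mul_right _ h2
      _ = (n / M + 1) * ((countBelow J M + 1) * N) := by ring
      _ ≤ (n / M + 1) * (2 * M) := Nat.mul_le_mul_left _ h3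
      _ = 2 * ((n / M + 1) * M) := by ring
      _ ≤ _ := Nat.mul_le_mul_left _ h4
  have h6 : (countBelow (periodicCuts J M) n : ℝ) * N ≤ 2 * (n + M) := by exact_mod_cast h5
  rw [show 2 * (M : ℝ) / N + 2 / N * n = 2 * (n + M) / N by ring, le_div_iff₀ hN']
  exact h6

lemma inLanguage_periodic {u : ℕ → A} {J : Set ℕ} {M : ℕ} (hM : 0 < M)
    (hu : ∀ a k, a + k ≤ M → (∀ j ∈ J, a < j → a + k ≤ j) → InLanguage X u a k) {n k : ℕ}
    (h : ∀ i < k, n + i ∉ periodicCuts J M) : InLanguage X (fun i => u (i % M)) n k := by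
  have hlt := Nat.mod_lt n hM
  have hmod : ∀ i, n % M + i < M → (n + i) % M = n % M + i := by
    intro i hi
    rw [← Nat.mod_add_mod, Nat.mod_eq_of_lt hi]
  -- Multiples of `M` are cuts, so the window stays inside one period.
  have hk : n % M + k ≤ M := by
    by_contra! hcon
    refine h (M - n % M) (by omega) (Or.inr ?_)
    rw [← Nat.mod_add_mod, Nat.add_sub_cancel' hlt.le, Nat.mod_self]
  refine (hu (n % M) k hk fun j hj hnj => ?_).congr fun i hi => ?_
  · by_contra! hcon
    refine h (j - n % M) (by omega) (Or.inl ?_)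
    rw [hmod _ (by omega), Nat.add_sub_cancel' hnj.le]
    exact hj
  · simp only [hmod i (by omega)]

/-- Finite words with few cuts are approximated by words of the language. -/
lemma TracesAlmostInLanguage.exists_countBelow_le (h : TracesAlmostInLanguage X) {ε : ℝ}
    (hε : 0 < ε) : ∃ N : ℕ, 1 ≤ N ∧ ∀ M, N ≤ M → ∀ (u : ℕ → A) (J : Set ℕ),
      countBelow J M * N ≤ M →
      (∀ a k, a + k ≤ M → (∀ j ∈ J, a < j → a + k ≤ j) → InLanguage X u a k) →
      ∃ v ∈ X.carrier, (countBelow {i | v i ≠ u i} M : ℝ) ≤ ε * M := by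
  -- Otherwise each `m` has a bad word `u m` of length `M m ≥ m + 1` with at most `M m / (m + 1)`
  -- cuts, which every point of `X` misses in more than `ε * M m` places.
  by_contra! hcon
  have hcon' := fun m : ℕ => hcon (m + 1) (by omega)
  choose M hNM u J hJ hu hbad using hcon'
  have hM : ∀ m, 0 < M m := fun m => lt_of_lt_of_le (Nat.succ_pos m) (hNM m)
  set p : ℕ → ℕ → A := fun m i => u m (i % M m) with hp
  have hdens : ∀ m, ∀ k ≤ m, upperDensity (periodicCuts (J m) (M m)) < 3 / ((k : ℝ) + 1) := by
    intro m k hk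
    refine (upperDensity_periodicCuts_le (Nat.succ_pos m) (hNM m) (hJ m)).trans_lt ?_
    have hk' : (k : ℝ) + 1 ≤ m + 1 := by exact_mod_cast Nat.succ_le_succ hk
    have : (0 : ℝ) < k + 1 := by positivity
    push_cast
    rw [div_lt_div_iff₀ (by positivity) (by positivity)]
    linarith
  -- The lower bound makes both `M m` and `t m` negligible against `t (m + 1)`.
  obtain ⟨t, h0, ht, htsq, htb, hglue⟩ := exists_times (fun m => (m + 1) * M m)
    (E := fun m _ => periodicCuts (J m) (M m)) (c := fun k => 3 / ((k : ℝ) + 1))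
    (fun k => by positivity) hdens
  set y : ℕ → A := fun n => p (stage t n) n with hy
  have hnull : upperDensity {n | n ∈ periodicCuts (J (stage t n)) (M (stage t n))} = 0 := by
    rw [upperDensity_eq_zero_iff_le]
    refine ge_of_tendsto' (x := atTop) (f := fun k : ℕ => 3 * (3 / ((k : ℝ) + 1))) ?_ hglue
    have := tendsto_one_div_add_atTop_nhds_zero_nat (𝕜 := ℝ)
    convert this.const_mul 9 using 2
    · ring
    · simp
  obtain ⟨z, hz, hzy⟩ := h y <| almostInLanguage_of_cuts
    (upperDensity_union_eq_zero (upperDensity_range_eq_zero htsq) hnull) fun n k hk => by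
      simp only [Set.mem_union, Set.mem_range, Set.mem_ofPred_eq, not_or, not_exists] at hk
      have hst := stage_spec h0 ht n
      have hend : n + k ≤ t (stage t n + 1) := by
        by_contra! hlt
        refine (hk (t (stage t n + 1) - n) (by omega)).1 _ (Nat.add_sub_cancel' hst.2.le).symm
      have hstage : ∀ i < k, stage t (n + i) = stage t n := fun i hi =>
        stage_eq h0 ht (by omega) (by omega)
      refine (inLanguage_periodic (hM (stage t n)) (hu (stage t n)) (n := n) (k := k)
        fun i hi hmem => (hk i hi).2 (by rwa [hstage i hi])).congr fun i hi => ?_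
      simp only [hy, hp, hstage i hi]
  -- Every full period below `t (m + 1)` costs at least `ε * M m` errors, as shifts of `z` stay in
  -- `X`. The incomplete last period loses at most `ε * M m`, and the earlier stages, where `y` is
  -- not `p m`, at most `t m`.
  have hfar : ∀ m, ε * t (m + 1) - ε * M m - t m ≤ countBelow {n | z n ≠ y n} (t (m + 1)) := by
    intro m
    set T := t (m + 1) with hT
    have h1 : ∀ q, ε * M m ≤ countBelow {i | q * M m + i ∈ {n | z n ≠ p m n}} (M m) := by
      intro q
      refine (hbad m _ (shift_mem X hz (q * M m))).le.trans ?_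
      refine Nat.cast_le.2 (countBelow_le_of_forall fun i hi h => ?_)
      simpa [hp, Nat.mod_eq_of_lt hi] using h
    have h2 := mul_countBelow_le_of_periodic h1 (T / M m)
    have h3 := countBelow_mono {n | z n ≠ p m n} (Nat.div_mul_le_self T (M m))
    have h4 : countBelow {n | z n ≠ p m n} T ≤ t m + countBelow {n | z n ≠ y n} T := by
      obtain ⟨b, hb⟩ := Nat.exists_eq_add_of_le (ht (Nat.lt_succ_self m)).le
      rw [Nat.succ_eq_add_one, ← hT] at hb
      rw [hb, countBelow_add, countBelow_add {n | z n ≠ y n}]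
      have h5 := countBelow_le {n | z n ≠ p m n} (t m)
      have h6 : countBelow {i | t m + i ∈ {n | z n ≠ p m n}} b ≤
          countBelow {i | t m + i ∈ {n | z n ≠ y n}} b := by
        refine countBelow_le_of_forall fun i hi h => ?_
        have : stage t (t m + i) = m := stage_eq h0 ht (by omega) (by omega)
        simpa [hy, this] using h
      omega
    have h5 : (T : ℝ) ≤ (T / M m : ℕ) * M m + M m := by
      exact_mod_cast (Nat.lt_div_mul_add (hM m)).le
    have h6 : (countBelow {n | z n ≠ p m n} (T / M m * M m) : ℝ) ≤
        t m + countBelow {n | z n ≠ y n} T := by exact_mod_cast h3.trans h4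
    nlinarith
  obtain ⟨n₀, hn₀⟩ := eventually_atTop.1
    (eventually_countBelow_le (c := ε / 2) (hzy.trans_lt (by positivity)))
  -- For such `m` the losses in `hfar` are below `ε / 2 * t (m + 1)`.
  obtain ⟨K, hK⟩ := exists_nat_gt (2 * (ε + 1) / ε)
  set m := max n₀ K with hm
  have h1 := hn₀ (t (m + 1)) (((le_max_left _ _).trans (Nat.le_succ _)).trans ht.le_apply)
  have h2 := hfar m
  have h3 : ((m : ℝ) + 2) * t m + (m + 1) * M m ≤ t (m + 1) := by exact_mod_cast htb m
  have h4 : (0 : ℝ) < t (m + 1) := by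
    have := ht.le_apply (x := m + 1)
    exact_mod_cast lt_of_lt_of_le (Nat.succ_pos m) this
  have h5 : 2 * (ε + 1) < m * ε := by
    rw [div_lt_iff₀ hε] at hK
    have : (K : ℝ) ≤ m := by exact_mod_cast le_max_right _ _
    nlinarith
  have h6 : ((m : ℝ) + 1) * (ε * M m + t m) ≤ (ε + 1) * t (m + 1) := by
    have h7 : ((m : ℝ) + 1) * M m ≤ t (m + 1) := by
      have : (0 : ℝ) ≤ ((m : ℝ) + 2) * t m := by positivity
      linarith
    have h8 : ((m : ℝ) + 1) * t m ≤ t (m + 1) := by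
      have : (0 : ℝ) ≤ ((m : ℝ) + 1) * M m := by positivity
      have : (0 : ℝ) ≤ t m := by positivity
      linarith
    nlinarith
  have h7 : ε / 2 * t (m + 1) ≤ ε * M m + t m := by linarith
  have h8 : ((m : ℝ) + 1) * (ε / 2 * t (m + 1)) ≤ (ε + 1) * t (m + 1) :=
    (mul_le_mul_of_nonneg_left h7 (by positivity)).trans h6
  have h9 : ((m : ℝ) + 1) * (ε / 2) ≤ ε + 1 :=
    le_of_mul_le_mul_right (by linarith) h4
  linarith

end Main

/-! ### Infinite concatenations -/

section Concat

variable {A : Type*}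

/-- The position at which the `i`-th word starts in the concatenation. -/
def wordStart (w : ℕ → List A) (i : ℕ) : ℕ := ((List.range i).flatMap w).length

lemma wordStart_zero (w : ℕ → List A) : wordStart w 0 = 0 := by simp [wordStart]

lemma wordStart_succ (w : ℕ → List A) (i : ℕ) :
    wordStart w (i + 1) = wordStart w i + (w i).length := by
  simp [wordStart, List.range_succ]

lemma flatMap_range_prefix (w : ℕ → List A) {m n : ℕ} (h : m ≤ n) :
    (List.range m).flatMap w <+: (List.range n).flatMap w := by
  induction n, h using Nat.le_induction with
  | base => exact List.prefix_rfl
  | succ n _ ih =>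
    refine ih.trans ?_
    rw [List.range_succ, List.flatMap_append]
    exact List.prefix_append _ _

lemma concat_wordStart_add (w : ℕ → List A) (hw : ∀ i, w i ≠ []) (i p : ℕ)
    (hp : p < (w i).length) : concat w hw (wordStart w i + p) = (w i)[p] := by
  have h1 : i ≤ wordStart w i := le_length_flatMap_range w hw i
  have h2 : wordStart w i + p < ((List.range (i + 1)).flatMap w).length := by
    have := wordStart_succ w i
    rw [wordStart] at this
    omega
  have h3 := (flatMap_range_prefix w (show i + 1 ≤ wordStart w i + p + 1 by omega)).getElem h2
  rw [concat, ← h3]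
  simp [List.range_succ, List.flatMap_append, wordStart, List.getElem_append_right]

lemma strictMono_wordStart (w : ℕ → List A) (hw : ∀ i, w i ≠ []) : StrictMono (wordStart w) :=
  strictMono_nat_of_lt_succ fun i => by
    have := List.length_pos_iff.mpr (hw i)
    rw [wordStart_succ]
    omega

lemma wordStart_add_le (w : ℕ → List A) (hw : ∀ i, w i ≠ []) {N : ℕ}
    (hN : ∀ i, N ≤ (w i).length) {i j : ℕ} (h : wordStart w i < wordStart w j) :
    wordStart w i + N ≤ wordStart w j := by
  have hmono := strictMono_wordStart w hw
  have h1 : i + 1 ≤ j := hmono.lt_iff_lt.1 h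
  have h2 := hmono.monotone h1
  rw [wordStart_succ] at h2
  have := hN i
  omega

variable [TopologicalSpace A] {X : Subshift A ℕ}

lemma inLanguage_concat (w : ℕ → List A) (hw : ∀ i, w i ≠ []) (hX : ∀ i, w i ∈ language X)
    {a k : ℕ} (h : ∀ j ∈ Set.range (wordStart w), a < j → a + k ≤ j) :
    InLanguage X (concat w hw) a k := by
  obtain ⟨h1, h2⟩ := stage_spec (wordStart_zero w) (strictMono_wordStart w hw) a
  set i := stage (wordStart w) a
  have h3 := h _ ⟨i + 1, rfl⟩ h2
  rw [wordStart_succ] at h3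
  obtain ⟨x, hx, hxw⟩ := hX i
  have h4 : InLanguage X (concat w hw) (wordStart w i) (w i).length :=
    ⟨x, hx, fun p hp => by rw [hxw p hp, concat_wordStart_add w hw i p hp]⟩
  exact h4.subword h1 h3

/-! ### Shadowing of sequences with sparse cuts -/

/-- Separation makes `i ↦ i / N` injective on the translated set. -/
lemma countBelow_le_of_separated {J : Set ℕ} {N : ℕ} (hN : 0 < N)
    (hJ : ∀ a ∈ J, ∀ b ∈ J, a < b → a + N ≤ b) (a M : ℕ) :
    countBelow {i | a + i ∈ J} M ≤ M / N + 1 := by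
  have hlt : ∀ i j, a + i ∈ J → a + j ∈ J → i < j → i / N < j / N := by
    intro i j hi hj hij
    have h1 := hJ _ hi _ hj (by omega)
    have h2 : (i + N) / N ≤ j / N := Nat.div_le_div_right (by omega)
    rw [Nat.add_div_right _ hN] at h2
    omega
  have h := Set.ncard_le_ncard_of_injOn (s := {i | a + i ∈ J} ∩ Set.Ico 0 M)
    (t := (Finset.range (M / N + 1) : Set ℕ)) (fun i => i / N) ?_ ?_ (Finset.finite_toSet _)
  · rwa [Set.ncard_coe_finset, Finset.card_range] at h
  · rintro i ⟨_, hi⟩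
    simp only [Set.mem_Ico] at hi
    have : i / N ≤ M / N := Nat.div_le_div_right hi.2.le
    simp only [Finset.coe_range, Set.mem_Iio]
    omega
  · rintro i ⟨hi, _⟩ j ⟨hj, _⟩ hij
    simp only at hij
    rcases lt_trichotomy i j with h | h | h
    · exact absurd hij (hlt i j hi hj h).ne
    · exact h
    · exact absurd hij (hlt j i hj hi h).ne'

/-- The ratio of consecutive squares tends to `1`, so counts at squares determine the upper density.
-/
lemma upperDensity_le_of_squares {E : Set ℕ} {δ C : ℝ} (hδ : 0 ≤ δ) (hC : 0 ≤ C)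
    (h : ∀ m : ℕ, (countBelow E (m * m) : ℝ) ≤ C + δ * (m * m)) : upperDensity E ≤ δ := by
  rw [upperDensity_le_iff]
  intro η hη
  obtain ⟨K, hK⟩ := exists_nat_gt ((C + 3 * δ) / η)
  filter_upwards [eventually_ge_atTop ((K + 1) * (K + 1))] with n hn
  set m := Nat.sqrt n
  have h1 : (K : ℝ) + 1 ≤ m := by exact_mod_cast Nat.le_sqrt.2 hn
  have h2 : (m : ℝ) * m ≤ n := by exact_mod_cast Nat.sqrt_le n
  have h3 : (countBelow E n : ℝ) ≤ countBelow E ((m + 1) * (m + 1)) := by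
    exact_mod_cast countBelow_mono E (Nat.lt_succ_sqrt n).le
  have h4 := h (m + 1)
  push_cast at h4
  rw [div_lt_iff₀ hη] at hK
  have h5 : (1 : ℝ) ≤ m := by linarith [K.cast_nonneg (α := ℝ)]
  have h6 : C + 3 * δ ≤ η * m := by nlinarith
  have h7 : (C + 3 * δ) * m ≤ η * m * m := mul_le_mul_of_nonneg_right h6 (by linarith)
  have h8 : C + δ * (2 * m + 1) ≤ (C + 3 * δ) * m := by nlinarith
  nlinarith

/-- On each block from `m * m` to `(m + 1) * (m + 1)`, `c` is replaced by the prefix of a point of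
`X` approximating it. The new sequence has cuts only at the squares, a null set, so it can be traced
exactly, whereas the cuts `J` of `c` may have positive density. -/
lemma TracesAlmostInLanguage.exists_dbar_lt (h : TracesAlmostInLanguage X)
    (hne : X.carrier.Nonempty) {ε : ℝ} (hε : 0 < ε) :
    ∃ N : ℕ, 1 ≤ N ∧ ∀ (c : ℕ → A) (J : Set ℕ), (∀ a ∈ J, ∀ b ∈ J, a < b → a + N ≤ b) →
      (∀ a k, (∀ j ∈ J, a < j → a + k ≤ j) → InLanguage X c a k) →
      ∃ x ∈ X.carrier, dbar x c < ε := by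
  obtain ⟨N, hN, happrox⟩ := h.exists_countBelow_le (half_pos hε)
  -- A block of length `L ≥ 2 * N` has at most `L / (2 * N) + 1 ≤ L / N` cuts, as the finite
  -- approximation requires.
  refine ⟨2 * N, by omega, fun c J hJ hc => ?_⟩
  have hv : ∀ m, ∃ v ∈ X.carrier, N ≤ m →
      (countBelow {i | v i ≠ c (m * m + i)} (2 * m + 1) : ℝ) ≤ ε / 2 * (2 * m + 1 : ℕ) := by
    intro m
    by_cases hm : N ≤ m
    · have hcount : countBelow {i | m * m + i ∈ J} (2 * m + 1) * N ≤ 2 * m + 1 := by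
        have h1 := countBelow_le_of_separated (by omega) hJ (m * m) (2 * m + 1)
        have h2 := Nat.div_mul_le_self (2 * m + 1) (2 * N)
        nlinarith
      obtain ⟨v, hv, hvc⟩ := happrox (2 * m + 1) (by omega) (fun i => c (m * m + i)) _ hcount
        fun a k _ hj => by
          refine (hc (m * m + a) k fun j hjJ haj => ?_).congr fun i _ => by rw [add_assoc]
          have := hj (j - m * m)
            (by rwa [Set.mem_ofPred_eq, Nat.add_sub_cancel' (by omega : m * m ≤ j)]) (by omega)
          omega
      exact ⟨v, hv, fun _ => hvc⟩
    · exact ⟨hne.some, hne.some_mem, fun h => absurd h hm⟩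
  choose v hvX hv using hv
  set y : ℕ → A := fun n => v (Nat.sqrt n) (n - Nat.sqrt n * Nat.sqrt n) with hy
  have hsqrt : ∀ m i, i < 2 * m + 1 → Nat.sqrt (m * m + i) = m := fun m i hi =>
    (Nat.eq_sqrt.2 ⟨by omega, by nlinarith⟩).symm
  have hyv : ∀ m i, i < 2 * m + 1 → y (m * m + i) = v m i := by
    intro m i hi
    simp only [hy, hsqrt m i hi, Nat.add_sub_cancel_left]
  obtain ⟨x, hx, hxy⟩ := h y <| almostInLanguage_of_cuts
    (upperDensity_range_eq_zero (t := fun m => m * m) fun m => le_rfl) fun n k hk => by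
      obtain ⟨a, ha⟩ := Nat.exists_eq_add_of_le (Nat.sqrt_le n)
      have hlt : n < (Nat.sqrt n + 1) * (Nat.sqrt n + 1) := Nat.lt_succ_sqrt n
      set m := Nat.sqrt n
      have hexp : (m + 1) * (m + 1) = m * m + (2 * m + 1) := by ring
      have hend : n + k ≤ (m + 1) * (m + 1) := by
        by_contra! hcon
        exact hk ((m + 1) * (m + 1) - n) (by omega) ⟨m + 1, by simp only; omega⟩
      refine (inLanguage_of_mem (hvX m) a k).congr fun i hi => ?_
      rw [ha, add_assoc, hyv m (a + i) (by omega)]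
  refine ⟨x, hx, ?_⟩
  have hdist : dbar y c ≤ ε / 2 := by
    -- The constant pays for the blocks with `m < N`, where `v m` is arbitrary.
    refine upperDensity_le_of_squares (C := N * N) (by positivity) (by positivity) fun m => ?_
    induction m with
    | zero => simp [countBelow]; positivity
    | succ m ih =>
      have hexp : (m + 1) * (m + 1) = m * m + (2 * m + 1) := by ring
      rcases lt_or_ge m N with hm | hm
      · have h1 := countBelow_le {n | y n ≠ c n} ((m + 1) * (m + 1))
        have h2 : (m + 1) * (m + 1) ≤ N * N := Nat.mul_self_le_mul_self hm
        have h3 : (countBelow {n | y n ≠ c n} ((m + 1) * (m + 1)) : ℝ) ≤ N * N := by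
          exact_mod_cast h1.trans h2
        have : 0 ≤ ε / 2 * (((m + 1 : ℕ) : ℝ) * (m + 1 : ℕ)) := by positivity
        linarith
      · rw [hexp, countBelow_add]
        have h1 : countBelow {i | m * m + i ∈ {n | y n ≠ c n}} (2 * m + 1) ≤
            countBelow {i | v m i ≠ c (m * m + i)} (2 * m + 1) :=
          countBelow_le_of_forall fun i hi h => by
            simpa [hyv m i hi] using h
        have h2 : (countBelow {i | m * m + i ∈ {n | y n ≠ c n}} (2 * m + 1) : ℝ) ≤
            countBelow {i | v m i ≠ c (m * m + i)} (2 * m + 1) := by exact_mod_cast h1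
        have h3 := hv m hm
        push_cast at h3 ⊢
        nlinarith
  have := dbar_triangle x y c
  linarith

lemma TracesAlmostInLanguage.dbarShadowing (h : TracesAlmostInLanguage X)
    (hne : X.carrier.Nonempty) : DbarShadowing X := by
  intro ε hε
  obtain ⟨N, hN, hc⟩ := h.exists_dbar_lt hne hε
  refine ⟨N, hN, fun w hw hX hlen => hc _ (Set.range (wordStart w)) ?_ fun a k hak =>
    inLanguage_concat w hw hX hak⟩
  rintro _ ⟨i, rfl⟩ _ ⟨j, rfl⟩ hij
  exact wordStart_add_le w hw hlen hij

/-! ### From `d̄`-shadowing and `d̄`-completeness back to tracing -/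

/-- Cut `y` into blocks of length `N` and replace the blocks outside the language by arbitrary
admissible words. Only letters in bad blocks change, a null set, and the result is a concatenation
to which shadowing applies. -/
lemma DbarShadowing.exists_dbar_lt (h : DbarShadowing X) (hne : X.carrier.Nonempty) {y : ℕ → A}
    (hy : AlmostInLanguage X y) {ε : ℝ} (hε : 0 < ε) : ∃ x ∈ X.carrier, dbar x y < ε := by
  obtain ⟨N, hN, hshadow⟩ := h ε hε
  have hx : ∀ j, ∃ x ∈ X.carrier, InLanguage X y (j * N) N → ∀ i < N, x i = y (j * N + i) := by
    intro j
    by_cases hj : InLanguage X y (j * N) N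
    · obtain ⟨x, hx, hxy⟩ := hj
      exact ⟨x, hx, fun _ => hxy⟩
    · exact ⟨hne.some, hne.some_mem, fun h => absurd h hj⟩
  choose x hxX hx using hx
  set w : ℕ → List A := fun j => List.ofFn fun i : Fin N => x j i with hw
  have hlen : ∀ j, (w j).length = N := fun j => by simp [hw]
  have hw0 : ∀ j, w j ≠ [] := fun j => List.length_pos_iff.1 (by rw [hlen]; omega)
  have hstart : ∀ j, wordStart w j = j * N := by
    intro j
    induction j with
    | zero => rw [wordStart_zero, zero_mul]
    | succ j ih => rw [wordStart_succ, ih, hlen, add_mul, one_mul]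
  obtain ⟨z, hz, hzw⟩ := hshadow w hw0
    (fun j => ⟨x j, hxX j, fun i hi => by simp [hw]⟩) (fun j => (hlen j).ge)
  refine ⟨z, hz, ?_⟩
  have hnull : dbar (concat w hw0) y = 0 := by
    -- A changed letter at `n` lies `i = n % N` places after the start of a bad window: a union of
    -- `N` translates of a null set.
    refine upperDensity_eq_zero_of_subset
      (F := {n | ∃ i < N, n ∈ {n | i ≤ n ∧ n - i ∈ {n | ¬ InLanguage X y n N}}}) ?_
      (upperDensity_exists_lt_eq_zero fun i _ => upperDensity_eq_zero_iff_le.2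
        ((upperDensity_image_add_le _ i).trans (hy N).le))
    intro n hn
    have hmod := Nat.mod_lt n (show 0 < N by omega)
    have hdiv : n / N * N + n % N = n := by rw [mul_comm]; exact Nat.div_add_mod n N
    refine ⟨n % N, hmod, Nat.mod_le n N, fun hcon => hn ?_⟩
    rw [show n - n % N = n / N * N by omega] at hcon
    have h1 := concat_wordStart_add w hw0 (n / N) (n % N) (by rwa [hlen])
    rw [hstart, hdiv] at h1
    rw [h1]
    simp only [hw, List.getElem_ofFn]
    rw [hx _ hcon _ hmod, hdiv]
  have := dbar_triangle z (concat w hw0) y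
  linarith

lemma DbarComplete.tracesAlmostInLanguage (hc : DbarComplete X) (h : DbarShadowing X)
    (hne : X.carrier.Nonempty) : TracesAlmostInLanguage X := by
  intro y hy
  choose x hxX hx using fun m : ℕ =>
    h.exists_dbar_lt hne hy (Nat.one_div_pos_of_nat (α := ℝ) (n := m))
  have hlim : Tendsto (fun m => dbar (x m) y) atTop (𝓝 0) :=
    squeeze_zero (fun m => dbar_nonneg _ _) (fun m => (hx m).le)
      tendsto_one_div_add_atTop_nhds_zero_nat
  obtain ⟨z, hz, hxz⟩ := hc x hxX fun ε hε => by
    obtain ⟨N, hN⟩ := eventually_atTop.1 (hlim.eventually (gt_mem_nhds (half_pos hε)))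
    refine ⟨N, fun n hn m hm => ?_⟩
    have h1 := dbar_triangle (x n) y (x m)
    rw [dbar_comm y] at h1
    linarith [hN n hn, hN m hm]
  refine ⟨z, hz, le_antisymm ?_ (dbar_nonneg _ _)⟩
  refine ge_of_tendsto' (by simpa using hxz.add hlim) fun m => ?_
  have := dbar_triangle z (x m) y
  rwa [dbar_comm z (x m)] at this

lemma tracesAlmostInLanguage_iff (hne : X.carrier.Nonempty) :
    TracesAlmostInLanguage X ↔ DbarComplete X ∧ DbarShadowing X :=
  ⟨fun h => ⟨h.dbarComplete, h.dbarShadowing hne⟩,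
    fun h => h.1.tracesAlmostInLanguage h.2 hne⟩

end Concat

end
end ShiftSpace

theorem mainTheorem9 {A : Type*} [Finite A] [TopologicalSpace A] [DiscreteTopology A]
    (X : Subshift A ℕ) (hne : X.carrier.Nonempty)
    (hsurj : Function.Surjective (ShiftSpace.shiftMap X)) :
    (ShiftSpace.AsymptoticAverageShadowing (ShiftSpace.shiftMap X) ↔
      ShiftSpace.DbarComplete X ∧ ShiftSpace.DbarShadowing X) ∧
    (ShiftSpace.VagueSpecification (ShiftSpace.shiftMap X) ↔
      ShiftSpace.DbarComplete X ∧ ShiftSpace.DbarShadowing X) := by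
  rw [ShiftSpace.asymptoticAverageShadowing_iff_tracesWindows,
    ShiftSpace.vagueSpecification_iff_tracesWindows, ShiftSpace.tracesWindows_iff hne,
    ShiftSpace.tracesAlmostInLanguage_iff hne]
  exact ⟨Iff.rfl, Iff.rfl⟩
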